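/- Let $G_1,\dots,G_k$ be finite simple graphs (not necessarily distinct), none of which is complete or edgeless, such that $G_\ell$ is strongly regular with parameters $\mathrm{srg}(n_\ell,d_\ell,\lambda_\ell,\mu_\ell)$ for each $\ell=1,\dots,k$; that is, $G_\ell$ is $d_\ell$-regular on $n_\ell$ vertices, every two adjacent vertices have exactly $\lambda_\ell$ common neighbors, and every two distinct nonadjacent vertices have exactly $\mu_\ell$ common neighbors. Put $$t_\ell=\sqrt{(\lambda_\ell-\mu_\ell)^2+4(d_\ell-\mu_\ell)},\qquad \ell=1,\dots,k.$$ Let $G_1\boxtimes\cdots\boxtimes G_k$ be the strong product: its vertices are the tuples $(u_1,\dots,u_k)$ with $u_\ell$ a vertex of $G_\ell$, and two distinct tuples $u,v$ are adjacent if and only if, for every $\ell$, either $u_\ell=v_\ell$ or $u_\ell$ and $v_\ell$ are adjacent in $G_\ell$. Then, with $\chi$ the chromatic number and $\omega$ the clique number, $$\left\lceil\prod_{\ell=1}^k\left(1+\frac{2d_\ell}{t_\ell+\mu_\ell-\lambda_\ell}\right)\right\rceil\le\chi(G_1\boxtimes\cdots\boxtimes G_k)\le\prod_{\ell=1}^k\chi(G_\ell),$$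 and $$\left\lceil\prod_{\ell=1}^k\left(1+\frac{2d_\ell}{t_\ell+\mu_\ell-\lambda_\ell}\right)\right\rceil\ge\prod_{\ell=1}^k\omega(G_\ell).$$ -/

import Mathlib

/-- The strong product of a family of simple graphs: the vertices are the tuples `u` with
`u i ∈ V i`, and two distinct tuples are adjacent if and only if, in every coordinate, their
entries are equal or adjacent. For two factors these are the usual three cases (equal and adjacent,
adjacent and equal, adjacent and adjacent). -/
def strongProduct {ι : Type*} {V : ι → Type*} (G : ∀ i, SimpleGraph (V i)) :
    SimpleGraph (∀ i, V i) where
  Adj u v := u ≠ v ∧ ∀ i, u i = v i ∨ (G i).Adj (u i) (v i)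
  symm := ⟨fun _ _ h => ⟨h.1.symm, fun i => (h.2 i).imp Eq.symm fun e => e.symm⟩⟩
  loopless := ⟨fun _ h => h.1 rfl⟩

/-! Each factor supplies the Lovász-type certificate `A - τI`, with `τ < 0` the least eigenvalue. It
is positive semidefinite, vanishes at distinct nonadjacent pairs, and has entry sum `n(d - τ)` and
trace `-nτ`; the quotient `(d - τ)/(-τ)` is the stated factor. Such certificates tensor over the
strong product, and there `sum_sum_le_card_mul_trace` bounds the quotient by the number of colours.
The clique inequality holds factor by factor, from the other eigenvalue `r`. Both spectral facts
come from `quadratic_form_le`, with the roles of `τ` and `r` exchanged, so no diagonalisation is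
needed. -/

open Finset Matrix in
/-- If a positive semidefinite matrix `P` vanishes at the pairs of distinct nonadjacent vertices of a
graph with a proper colouring in `α`, then the sum of its entries is at most `|α|` times its trace. -/
theorem SimpleGraph.Coloring.sum_sum_le_card_mul_trace {W α : Type*} [Fintype W] [Fintype α]
    {H : SimpleGraph W} (col : H.Coloring α) {P : Matrix W W ℝ} (hP : P.PosSemidef)
    (h0 : ∀ u v, u ≠ v → ¬H.Adj u v → P u v = 0) :
    ∑ u, ∑ v, P u v ≤ Fintype.card α * P.trace := by
  classical
  obtain ⟨K, rfl⟩ : ∃ K : Matrix W W ℝ, P = Kᴴ * K := by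
    open scoped MatrixOrder in
    exact CStarAlgebra.nonneg_iff_eq_star_mul_self.mp hP.nonneg
  set P := Kᴴ * K with hPdef
  have hPK : ∀ u v, P u v = ∑ w, K w u * K w v := fun u v => by
    simp [hPdef, Matrix.mul_apply]
  have gram : ∀ f : W → ℝ, ∑ u, ∑ v, f u * f v * P u v = ∑ w, (∑ u, f u * K w u) ^ 2 := by
    intro f
    simp_rw [hPK, sq, sum_mul_sum, mul_sum]
    calc _ = ∑ u, ∑ w, ∑ v, f u * f v * (K w u * K w v) := sum_congr rfl fun _ _ => sum_comm
      _ = ∑ w, ∑ u, ∑ v, f u * f v * (K w u * K w v) := sum_comm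
      _ = _ := by simp only [mul_mul_mul_comm]
  let f : α → W → ℝ := fun c u => if col u = c then 1 else 0
  -- A colour class is independent, so only the diagonal of `P` survives on it.
  have hclass : ∀ c, ∑ u, ∑ v, f c u * f c v * P u v = ∑ u, f c u * P u u := by
    intro c
    refine sum_congr rfl fun u _ => ?_
    rw [sum_eq_single u]
    · by_cases h : col u = c <;> simp [f, h]
    · intro v _ hvu
      by_cases hu : col u = c
      · by_cases hv : col v = c
        · rw [h0 u v hvu.symm fun hadj => col.valid hadj (hu.trans hv.symm), mul_zero]
        · simp [f, hv]
      · simp [f, hu]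
    · simp
  calc ∑ u, ∑ v, P u v = ∑ w, (∑ u, K w u) ^ 2 := by simpa using gram fun _ => 1
    _ = ∑ w, (∑ c, ∑ u, f c u * K w u) ^ 2 := by
      refine sum_congr rfl fun w _ => ?_
      rw [sum_comm]
      simp [f]
    -- The all-ones vector is the sum of the class indicators; Cauchy–Schwarz over the colours costs
    -- the factor `|α|`.
    _ ≤ ∑ w, Fintype.card α * ∑ c, (∑ u, f c u * K w u) ^ 2 :=
      sum_le_sum fun w _ => sq_sum_le_card_mul_sum_sq
    _ = Fintype.card α * ∑ c, ∑ u, f c u * P u u := by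
      rw [← mul_sum, sum_comm]
      simp only [← gram, hclass]
    _ = Fintype.card α * P.trace := by
      rw [sum_comm]
      simp [f, Matrix.trace]

open Finset Matrix in
/-- The tensor product of a finite family of real positive semidefinite matrices is positive
semidefinite. -/
theorem Matrix.PosSemidef.piProd {ι : Type*} [Fintype ι] {V : ι → Type*}
    [∀ i, Fintype (V i)] {M : ∀ i, Matrix (V i) (V i) ℝ} (hM : ∀ i, (M i).PosSemidef) :
    (Matrix.of fun u v : ∀ i, V i => ∏ i, M i (u i) (v i)).PosSemidef := by
  classical
  have hK : ∀ i, ∃ K : Matrix (V i) (V i) ℝ, M i = Kᴴ * K := fun i => by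
    open scoped MatrixOrder in
    exact CStarAlgebra.nonneg_iff_eq_star_mul_self.mp (hM i).nonneg
  choose K hK using hK
  -- A tensor product of Gram matrices is the Gram matrix of the tensored factors.
  convert! posSemidef_conjTranspose_mul_self
    (Matrix.of fun w u : ∀ i, V i => ∏ i, K i (w i) (u i)) using 1
  ext u v
  simp only [of_apply, hK, Matrix.mul_apply, conjTranspose_apply, star_trivial, prod_univ_sum,
    Fintype.piFinset_univ, prod_mul_distrib]

open Finset in
/-- The colouring bound for strong products: tensor together positive semidefinite matrices that
vanish at the pairs of distinct nonadjacent vertices of the factors. -/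
theorem prod_sum_le_mul_prod_trace_of_colorable {ι : Type*} [Fintype ι] {V : ι → Type*}
    [∀ i, Fintype (V i)] {G : ∀ i, SimpleGraph (V i)} {M : ∀ i, Matrix (V i) (V i) ℝ}
    (hM : ∀ i, (M i).PosSemidef) (h0 : ∀ i u v, u ≠ v → ¬(G i).Adj u v → M i u v = 0)
    {m : ℕ} (hm : (strongProduct G).Colorable m) :
    ∏ i, ∑ u, ∑ v, M i u v ≤ m * ∏ i, (M i).trace := by
  classical
  have key := hm.some.sum_sum_le_card_mul_trace (Matrix.PosSemidef.piProd hM) fun u v huv hadj => by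
    obtain ⟨i, hi⟩ : ∃ i, ¬(u i = v i ∨ (G i).Adj (u i) (v i)) := by
      by_contra! h
      exact hadj ⟨huv, h⟩
    rw [not_or] at hi
    exact prod_eq_zero (mem_univ i) (h0 i _ _ hi.1 hi.2)
  simpa only [Matrix.trace, Matrix.diag, Matrix.of_apply, prod_univ_sum, Fintype.piFinset_univ,
    Fintype.card_fin] using key

/-- A product of colourings of the factors is a colouring of the strong product. -/
theorem chromaticNumber_strongProduct_le {ι : Type*} [Fintype ι] {V : ι → Type*}
    [∀ i, Fintype (V i)] (G : ∀ i, SimpleGraph (V i)) :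
    (strongProduct G).chromaticNumber ≤ ∏ i, (G i).chromaticNumber := by
  classical
  have hc : ∀ i, ∃ m : ℕ, (G i).chromaticNumber = m ∧ (G i).Colorable m := fun i => by
    obtain ⟨m, hm⟩ := ENat.ne_top_iff_exists.mp
      (SimpleGraph.chromaticNumber_ne_top_iff_exists.mpr ⟨_, (G i).colorable_of_fintype⟩)
    exact ⟨m, hm.symm, SimpleGraph.chromaticNumber_le_iff_colorable.mp hm.ge⟩
  choose m hm hcol using hc
  let col : (strongProduct G).Coloring (∀ i, Fin (m i)) :=
    SimpleGraph.Coloring.mk (fun u i => (hcol i).some (u i)) fun {u v} huv h => by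
      obtain ⟨i, hi⟩ := Function.ne_iff.mp huv.1
      exact (hcol i).some.valid ((huv.2 i).resolve_left hi) (congrFun h i)
  have := col.colorable.chromaticNumber_le
  simpa [hm] using this

/-! ### Spectral inequalities for strongly regular graphs. -/

namespace SimpleGraph.IsSRGWith

variable {V : Type*} [Fintype V] {G : SimpleGraph V} [DecidableRel G.Adj] {n d l m : ℕ}

-- As `A` is symmetric, the left side is `xᵀA²x`; expand `A² = dI + lA + m(J - I - A)`, where `J` is
-- the all-ones matrix.
open Matrix in
theorem dotProduct_sq_mulVec (h : G.IsSRGWith n d l m) (x : V → ℝ) :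
    (G.adjMatrix ℝ *ᵥ x) ⬝ᵥ (G.adjMatrix ℝ *ᵥ x) = (d - m) * (x ⬝ᵥ x)
      + (l - m) * (x ⬝ᵥ (G.adjMatrix ℝ *ᵥ x)) + m * (∑ v, x v) ^ 2 := by
  classical
  have hsq := h.matrix_eq (α := ℝ)
  have hcompl : Gᶜ.adjMatrix ℝ = Matrix.of (fun _ _ => 1) - 1 - G.adjMatrix ℝ := by
    ext u v
    rcases eq_or_ne u v with rfl | huv
    · simp
    · by_cases hadj : G.Adj u v <;> simp [adjMatrix_apply, huv, hadj]
  have hones : x ⬝ᵥ ((Matrix.of fun _ _ => (1 : ℝ)) *ᵥ x) = (∑ v, x v) ^ 2 := by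
    simp [dotProduct, mulVec, sq, Finset.sum_mul]
  have h1 : (G.adjMatrix ℝ *ᵥ x) ⬝ᵥ (G.adjMatrix ℝ *ᵥ x) = x ⬝ᵥ (G.adjMatrix ℝ ^ 2 *ᵥ x) := by
    rw [sq, ← mulVec_mulVec, dotProduct_mulVec x, ← mulVec_transpose, transpose_adjMatrix]
  rw [h1, hsq, hcompl]
  simp only [add_mulVec, sub_mulVec, smul_mulVec, one_mulVec, dotProduct_add, dotProduct_sub,
    dotProduct_smul, hones]
  simp only [nsmul_eq_mul]
  ring

open Matrix in
theorem sum_mulVec (h : G.IsSRGWith n d l m) (x : V → ℝ) :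
    ∑ v, (G.adjMatrix ℝ *ᵥ x) v = d * ∑ v, x v := by
  have : ∑ v, (G.adjMatrix ℝ *ᵥ x) v = (fun _ => 1) ⬝ᵥ (G.adjMatrix ℝ *ᵥ x) := by
    simp [dotProduct]
  rw [this, dotProduct_mulVec, ← mulVec_transpose, transpose_adjMatrix]
  simp [dotProduct, Finset.mul_sum, adjMatrix_mulVec_apply, h.regular.degree_eq]

open Matrix in
/-- Counting walks of length two in a strongly regular graph. -/
theorem card_mul_param_eq (h : G.IsSRGWith n d l m) (hn : 0 < n) :
    (n * m : ℝ) = d ^ 2 - (l - m) * d - (d - m) := by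
  have key := h.dotProduct_sq_mulVec fun _ => 1
  have hone : G.adjMatrix ℝ *ᵥ (fun _ => 1) = fun _ => (d : ℝ) := by
    ext v
    simp [adjMatrix_mulVec_apply, h.regular.degree_eq]
  simp only [hone, dotProduct, Finset.sum_const, Finset.card_univ, h.card, nsmul_eq_mul, mul_one,
    one_mul] at key
  have hn' : (n : ℝ) ≠ 0 := by positivity
  apply mul_left_cancel₀ hn'
  linear_combination -key

open Matrix in
/-- The quadratic form inequality behind the spectral bounds: `θ` and `θ'` are the two eigenvalues
other than the degree. -/
theorem quadratic_form_le (h : G.IsSRGWith n d l m) (hn : 0 < n) {θ θ' : ℝ}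
    (hadd : θ + θ' = l - m) (hmul : θ * θ' = m - d) (x : V → ℝ) :
    (d - θ) * (θ' - θ) * (∑ v, x v) ^ 2 ≤
      n * ((θ' - θ) * (x ⬝ᵥ (G.adjMatrix ℝ *ᵥ x) - θ * (x ⬝ᵥ x))) := by
  set y := G.adjMatrix ℝ *ᵥ x with hy
  -- Cauchy–Schwarz for `(A - θI)x` against the all-ones vector. Its squared norm is `(θ' - θ)(xᵀAx
  -- - θxᵀx) + m(∑ x)²`, and `nm = (d - θ)(d - θ')` absorbs the last term. Keeping the factor `θ' -
  -- θ` allows either order of the eigenvalues.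
  have hcs : (∑ v, (y v - θ * x v)) ^ 2 ≤ n * ∑ v, (y v - θ * x v) ^ 2 := by
    have := sq_sum_le_card_mul_sum_sq (s := Finset.univ) (f := fun v => y v - θ * x v)
    rwa [Finset.card_univ, h.card] at this
  have hsum : ∑ v, (y v - θ * x v) = (d - θ) * ∑ v, x v := by
    rw [Finset.sum_sub_distrib, h.sum_mulVec, ← Finset.mul_sum]
    ring
  have hsq : ∑ v, (y v - θ * x v) ^ 2 = y ⬝ᵥ y - 2 * θ * (x ⬝ᵥ y) + θ ^ 2 * (x ⬝ᵥ x) := by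
    simp only [dotProduct, Finset.mul_sum, ← Finset.sum_sub_distrib, ← Finset.sum_add_distrib]
    exact Finset.sum_congr rfl fun v _ => by ring
  rw [hsum, hsq, h.dotProduct_sq_mulVec, ← hy] at hcs
  have hp := h.card_mul_param_eq hn
  have h1 : (d : ℝ) - m = -(θ * θ') := by linarith
  rw [h1, ← hadd] at hcs hp
  have hp' := congrArg (· * (∑ v, x v) ^ 2) hp
  nlinarith

open Matrix in
/-- The adjacency matrix minus its least eigenvalue is positive semidefinite. -/
theorem posSemidef_adjMatrix_sub [DecidableEq V] (h : G.IsSRGWith n d l m) (hn : 0 < n) {τ r : ℝ}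
    (hadd : τ + r = l - m) (hmul : τ * r = m - d) (hτ : τ ≤ 0) (hτr : τ < r) :
    (G.adjMatrix ℝ - τ • (1 : Matrix V V ℝ)).PosSemidef := by
  refine .of_dotProduct_mulVec_nonneg ?_ fun x => ?_
  · ext u v
    simp [adjMatrix_apply, G.adj_comm, Matrix.one_apply, eq_comm]
  · have key := h.quadratic_form_le hn hadd hmul x
    have hn' : (0 : ℝ) < n := by positivity
    have hd : (0 : ℝ) ≤ d - τ := by linarith [(Nat.cast_nonneg d : (0 : ℝ) ≤ d)]
    have hr : 0 < r - τ := by linarith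
    have h0 : 0 ≤ (d - τ) * (r - τ) * (∑ v, x v) ^ 2 := by positivity
    have := nonneg_of_mul_nonneg_right (nonneg_of_mul_nonneg_right (h0.trans key) hn') hr
    simpa [sub_mulVec, dotProduct_sub, smul_mulVec] using this

open Matrix in
/-- The spectral clique bound for strongly regular graphs. -/
theorem card_clique_mul_le (h : G.IsSRGWith n d l m) (hdn : d < n) {τ r : ℝ}
    (hadd : τ + r = l - m) (hmul : τ * r = m - d) (hr0 : 0 ≤ r) (hτ : τ < 0)
    {s : Finset V} (hs : G.IsClique s) : (s.card : ℝ) * -τ ≤ d - τ := by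
  classical
  have hn : 0 < n := by omega
  let x : V → ℝ := fun v => if v ∈ s then 1 else 0
  have hsum : ∑ v, x v = s.card := by simp [x]
  have hxx : x ⬝ᵥ x = s.card := by simp [x, dotProduct]
  have hxA : x ⬝ᵥ (G.adjMatrix ℝ *ᵥ x) = s.card * (s.card - 1) := by
    have hrow : ∀ v ∈ s, (G.adjMatrix ℝ *ᵥ x) v = s.card - 1 := fun v hv => by
      have hset : G.neighborFinset v ∩ s = s.erase v := by
        ext w
        simp only [Finset.mem_inter, mem_neighborFinset, Finset.mem_erase]
        exact ⟨fun hw => ⟨hw.1.ne', hw.2⟩, fun hw => ⟨hs hv hw.2 hw.1.symm, hw.2⟩⟩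
      have hpos : 1 ≤ s.card := Finset.card_pos.mpr ⟨v, hv⟩
      simp [adjMatrix_mulVec_apply, x, Finset.sum_ite_mem, hset, Finset.card_erase_of_mem hv,
        Nat.cast_sub hpos]
    simp only [dotProduct, x, ite_mul, one_mul, zero_mul, Finset.sum_ite_mem, Finset.univ_inter]
    rw [Finset.sum_congr rfl hrow, Finset.sum_const, nsmul_eq_mul]
  -- Here `θ = r`, so the factor `τ - r` is negative and the form is bounded from above.
  have key := h.quadratic_form_le hn (by linarith : r + τ = l - m) (by linarith) x
  rw [hsum, hxx, hxA] at key
  rcases s.eq_empty_or_nonempty with rfl | hne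
  · have : (0 : ℝ) ≤ d := Nat.cast_nonneg d
    simp only [Finset.card_empty, Nat.cast_zero, zero_mul]
    linarith
  have hw : (0 : ℝ) < s.card := by exact_mod_cast hne.card_pos
  set w : ℝ := (s.card : ℝ)
  have hpos : 0 < (n : ℝ) - d + r := by
    have : (d : ℝ) < n := by exact_mod_cast hdn
    linarith
  have hgap : 0 < (r - τ) * w := mul_pos (by linarith) hw
  have h1 : w * (n - d + r) ≤ n * (1 + r) := by
    refine le_of_mul_le_mul_left ?_ hgap
    linarith
  have hp := h.card_mul_param_eq hn
  -- This is `nm = (d - τ)(d - r)` rewritten; it turns the bound `n(1 + r)/(n - d + r)` into `(d -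
  -- τ)/(-τ)`.
  have h2 : n * (1 + r) * -τ = (d - τ) * (n - d + r) := by
    have hd : (d : ℝ) - m = -(τ * r) := by linarith
    have hm : (m : ℝ) = d + τ * r := by linarith
    rw [hd, ← hadd, hm] at hp
    linear_combination -hp
  refine le_of_mul_le_mul_right ?_ hpos
  rw [← h2]
  nlinarith

/-- The least eigenvalue `τ` and the other eigenvalue `r` of a strongly regular graph that is neither
complete nor edgeless. -/
theorem eigenvalue_bounds (h : G.IsSRGWith n d l m) (htop : G ≠ ⊤) (hbot : G ≠ ⊥) {t τ r : ℝ}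
    (ht : t = √(((l : ℝ) - m) ^ 2 + 4 * ((d : ℝ) - m))) (hτ : τ = (l - m - t) / 2)
    (hr : r = (l - m + t) / 2) :
    τ + r = l - m ∧ τ * r = m - d ∧ τ < 0 ∧ 0 ≤ r ∧ d < n := by
  classical
  have hld : l < d := by
    obtain ⟨v, w, hvw⟩ := ne_bot_iff_exists_adj.mp hbot
    rw [← h.of_adj v w hvw, ← h.regular v]
    exact hvw.card_commonNeighbors_lt_degree
  obtain ⟨v, w, hvw, hnadj⟩ := ne_top_iff_exists_not_adj.mp htop
  have hmd : m ≤ d := by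
    rw [← h.of_not_adj hvw hnadj, ← h.regular v]
    exact G.card_commonNeighbors_le_degree_left v w
  have hdn : d < n := by
    rw [← h.card, ← h.regular v]
    exact G.degree_lt_card_verts v
  have hmd' : (m : ℝ) ≤ d := by exact_mod_cast hmd
  have hld' : (l : ℝ) < d := by exact_mod_cast hld
  have ht0 : 0 ≤ t := ht ▸ Real.sqrt_nonneg _
  have ht2 : t ^ 2 = ((l : ℝ) - m) ^ 2 + 4 * ((d : ℝ) - m) := by
    rw [ht, Real.sq_sqrt]
    nlinarith [sq_nonneg ((l : ℝ) - m)]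
  refine ⟨by rw [hτ, hr]; ring, by rw [hτ, hr]; linear_combination -ht2 / 4, ?_, ?_, hdn⟩
  · suffices (l : ℝ) - m < t by linarith
    -- Otherwise `t² ≤ (l - m)²` forces `d = m`, and then `0 ≤ t ≤ l - m` contradicts `l < d`.
    by_contra! hle
    nlinarith
  · suffices -((l : ℝ) - m) ≤ t by linarith
    exact (neg_le_abs _).trans (abs_le_of_sq_le_sq (by linarith [ht2]) ht0)

end SimpleGraph.IsSRGWith

theorem mainTheorem11 {k : ℕ} {V : Fin k → Type*} [∀ ℓ, Fintype (V ℓ)]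
    (G : ∀ ℓ, SimpleGraph (V ℓ)) [∀ ℓ, DecidableRel (G ℓ).Adj]
    (n d lam mu : Fin k → ℕ)
    (hG : ∀ ℓ, (G ℓ).IsSRGWith (n ℓ) (d ℓ) (lam ℓ) (mu ℓ))
    (hcomplete : ∀ ℓ, G ℓ ≠ ⊤) (hempty : ∀ ℓ, G ℓ ≠ ⊥)
    (t : Fin k → ℝ)
    (ht : ∀ ℓ, t ℓ = √(((lam ℓ : ℝ) - (mu ℓ : ℝ)) ^ 2 + 4 * ((d ℓ : ℝ) - (mu ℓ : ℝ)))) :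
    ((⌈∏ ℓ, (1 + 2 * (d ℓ : ℝ) / (t ℓ + (mu ℓ : ℝ) - (lam ℓ : ℝ)))⌉₊ : ℕ) : ℕ∞)
        ≤ (strongProduct G).chromaticNumber ∧
      (strongProduct G).chromaticNumber ≤ ∏ ℓ, (G ℓ).chromaticNumber ∧
      ∏ ℓ, (G ℓ).cliqueNum
        ≤ ⌈∏ ℓ, (1 + 2 * (d ℓ : ℝ) / (t ℓ + (mu ℓ : ℝ) - (lam ℓ : ℝ)))⌉₊ := by
  classical
  let τ : Fin k → ℝ := fun ℓ => (lam ℓ - mu ℓ - t ℓ) / 2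
  let r : Fin k → ℝ := fun ℓ => (lam ℓ - mu ℓ + t ℓ) / 2
  have hb := fun ℓ => (hG ℓ).eigenvalue_bounds (hcomplete ℓ) (hempty ℓ) (ht ℓ)
    (rfl : τ ℓ = _) (rfl : r ℓ = _)
  have hfactor : ∀ ℓ, 1 + 2 * (d ℓ : ℝ) / (t ℓ + mu ℓ - lam ℓ) = (d ℓ - τ ℓ) / -τ ℓ := fun ℓ => by
    have hτ : τ ℓ ≠ 0 := (hb ℓ).2.2.1.ne
    have hden : t ℓ + mu ℓ - lam ℓ = 2 * -τ ℓ := by simp only [τ]; ring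
    rw [hden]
    field_simp
    ring
  simp only [hfactor]
  refine ⟨?_, chromaticNumber_strongProduct_le G, ?_⟩
  · rw [SimpleGraph.le_chromaticNumber_iff_colorable]
    intro c hc
    rw [Nat.ceil_le]
    have key := prod_sum_le_mul_prod_trace_of_colorable
      (M := fun ℓ => (G ℓ).adjMatrix ℝ - τ ℓ • (1 : Matrix (V ℓ) (V ℓ) ℝ))
      (fun ℓ => by
        obtain ⟨h1, h2, h3, h4, h5⟩ := hb ℓ
        exact (hG ℓ).posSemidef_adjMatrix_sub (by omega) h1 h2 h3.le (by linarith))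
      (fun ℓ u v huv hadj => by simp [huv, hadj]) hc
    have hsum : ∀ ℓ, ∑ u, ∑ v, ((G ℓ).adjMatrix ℝ - τ ℓ • (1 : Matrix (V ℓ) (V ℓ) ℝ)) u v
        = n ℓ * (d ℓ - τ ℓ) := fun ℓ => by
      have hdeg : ∀ u, ∑ v, (G ℓ).adjMatrix ℝ u v = d ℓ := fun u => by
        simp [SimpleGraph.adjMatrix_apply, ← (hG ℓ).regular.degree_eq u,
          ← SimpleGraph.card_neighborFinset_eq_degree, SimpleGraph.neighborFinset_eq_filter]
      simp only [Matrix.sub_apply, Matrix.smul_apply, Finset.sum_sub_distrib, hdeg]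
      simp [Matrix.one_apply, (hG ℓ).card, mul_sub]
    have htr : ∀ ℓ, ((G ℓ).adjMatrix ℝ - τ ℓ • (1 : Matrix (V ℓ) (V ℓ) ℝ)).trace
        = n ℓ * -τ ℓ := fun ℓ => by
      simp [Matrix.trace_sub, (hG ℓ).card, mul_comm]
    simp only [hsum, htr] at key
    have hpos : ∀ ℓ, 0 < n ℓ * -τ ℓ := fun ℓ =>
      mul_pos (by exact_mod_cast (Nat.zero_le _).trans_lt (hb ℓ).2.2.2.2) (by linarith [(hb ℓ).2.2.1])
    calc ∏ ℓ, (d ℓ - τ ℓ) / -τ ℓ = ∏ ℓ, (n ℓ * (d ℓ - τ ℓ)) / (n ℓ * -τ ℓ) :=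
        Finset.prod_congr rfl fun ℓ _ => (mul_div_mul_left _ _ fun h0 => by
          simpa [h0] using hpos ℓ).symm
      _ ≤ c := by
        rw [Finset.prod_div_distrib, div_le_iff₀ (Finset.prod_pos fun ℓ _ => hpos ℓ)]
        exact key
  · rw [← Nat.cast_le (α := ℝ)]
    -- The real product already dominates, so the clique bound applies factor by factor.
    refine le_trans ?_ (Nat.le_ceil _)
    rw [Nat.cast_prod]
    refine Finset.prod_le_prod (fun _ _ => Nat.cast_nonneg _) fun ℓ _ => ?_
    obtain ⟨h1, h2, h3, h4, h5⟩ := hb ℓ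
    obtain ⟨s, hs⟩ := (G ℓ).exists_isNClique_cliqueNum
    rw [le_div_iff₀ (by linarith), ← hs.card_eq]
    exact (hG ℓ).card_clique_mul_le h5 h1 h2 h4 h3 hs.isClique
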